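/- Let $X$ be a finite set with $n$ elements, and let $(X,S)$ be a non-degenerate symmetric set-theoretical solution of the quantum Yang-Baxter equation: writing $S(x,y)=(g_x(y),f_y(x))$, the map $S:X\times X\to X\times X$ satisfies $S\circ S=\mathrm{Id}$ and $S^{12}S^{23}S^{12}=S^{23}S^{12}S^{23}$ on $X^3$ (where $S^{i\,i+1}$ is $S$ acting on the $i$th and $(i+1)$th components), and all maps $f_x,g_x:X\to X$ are bijective. Let $$G(X,S)=\langle X\mid xy=g_x(y)f_y(x)\ ;\ x,y\in X,\ S(x,y)\neq(x,y)\rangle$$ be its structure group. A pair $(x,y)\in X\times X$ is called frozen if $S(x,y)=(x,y)$; the element $xy$ of $G(X,S)$ is then called a frozen element. Let $V$ be a real vector space with basis $X$. For $x\in X$ put $\phi_x=f_x^{-1}$, and let $\psi_x\in GL(V)$ be defined by $\psi_x(y)=\phi_x(y)$ for $y\in X$, $y\neq x$, and $\psi_x(x)=-\phi_x(x)$. The map $x\mapsto\psi_x$ extends to a group morphism $\psi:G(X,S)\to GL(V)$; let $W(X,S)$ be its image and $N(X,S)$ its kernel. Assume that $(X,S)$ verifies Property $(\mathcal C)$: for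 every frozen pair $(x,y)$ one has $g_x\circ g_y=\mathrm{Id}_X$ and $f_y\circ f_x=\mathrm{Id}_X$. Then: 1. $N(X,S)$ is equal to the subgroup of $G(X,S)$ generated by the frozen elements. 2. There are exactly $n$ frozen elements in $G(X,S)$, and the subgroup that they generate is a free abelian group, freely generated by the frozen elements. In particular it is free abelian of rank $n$. 3. Consequently there is an exact sequence $$1\to N(X,S)\to G(X,S)\xrightarrow{\ \psi\ } W(X,S)\to 1$$ where $N(X,S)$ is a free abelian group of rank $n$. -/

import Mathlib

namespace YangBaxter

/-- The map `S¹²` on `X³`: apply `S` to the first two components. -/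
def map12 {X : Type*} (S : X × X → X × X) : X × X × X → X × X × X :=
  fun p => ((S (p.1, p.2.1)).1, (S (p.1, p.2.1)).2, p.2.2)

/-- The map `S²³` on `X³`: apply `S` to the last two components. -/
def map23 {X : Type*} (S : X × X → X × X) : X × X × X → X × X × X :=
  fun p => (p.1, S p.2)

/-- The map `g_x`, where `S (x, y) = (g_x y, f_y x)`. -/
def gMap {X : Type*} (S : X × X → X × X) (x : X) : X → X := fun y => (S (x, y)).1

/-- The map `f_y`, where `S (x, y) = (g_x y, f_y x)`. -/
def fMap {X : Type*} (S : X × X → X × X) (y : X) : X → X := fun x => (S (x, y)).2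

/-- A non-degenerate symmetric (that is, involutive and braided) set-theoretical solution
`(X, S)` of the quantum Yang-Baxter equation. -/
structure Solution (X : Type*) where
  /-- The underlying map. -/
  S : X × X → X × X
  /-- Non-degeneracy: all maps `g_x` are bijective. -/
  bijective_g : ∀ x, Function.Bijective (gMap S x)
  /-- Non-degeneracy: all maps `f_x` are bijective. -/
  bijective_f : ∀ x, Function.Bijective (fMap S x)
  /-- `S ∘ S = id`. -/
  involutive : S ∘ S = id
  /-- `S¹² S²³ S¹² = S²³ S¹² S²³`. -/
  braided : map12 S ∘ map23 S ∘ map12 S = map23 S ∘ map12 S ∘ map23 S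

namespace Solution

variable {X : Type*}

/-- The pair `(x, y)` is frozen: `S (x, y) = (x, y)`. -/
def IsFrozen (s : Solution X) (x y : X) : Prop := s.S (x, y) = (x, y)

/-- Property (C): `g_x ∘ g_y = id` and `f_y ∘ f_x = id` for every frozen pair `(x, y)`. -/
def PropertyC (s : Solution X) : Prop :=
  ∀ x y, s.IsFrozen x y →
    gMap s.S x ∘ gMap s.S y = id ∧ fMap s.S y ∘ fMap s.S x = id

/-- The relators `x y (g_x(y) f_y(x))⁻¹`, for the pairs `(x, y)` with `S (x, y) ≠ (x, y)`. -/
def relators (s : Solution X) : Set (FreeGroup X) :=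
  {r | ∃ x y : X, s.S (x, y) ≠ (x, y) ∧
    r = FreeGroup.of x * FreeGroup.of y *
      (FreeGroup.of (gMap s.S x y) * FreeGroup.of (fMap s.S y x))⁻¹}

/-- The structure group `G(X, S) = ⟨X ∣ x y = g_x(y) f_y(x), S (x, y) ≠ (x, y)⟩`. -/
abbrev StructureGroup (s : Solution X) : Type _ := PresentedGroup s.relators

/-- The generator of the structure group given by `x : X`. -/
def gen (s : Solution X) (x : X) : s.StructureGroup := PresentedGroup.of x

/-- The frozen elements of the structure group: the products `x y`, for `(x, y)` frozen. -/
def frozenElements (s : Solution X) : Set s.StructureGroup :=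
  {a | ∃ x y : X, s.IsFrozen x y ∧ a = s.gen x * s.gen y}

/-- The frozen subgroup: the subgroup of the structure group generated by the frozen elements. -/
def frozenSubgroup (s : Solution X) : Subgroup s.StructureGroup :=
  Subgroup.closure s.frozenElements

/-- The permutation `φ_x = f_x⁻¹` of `X`. -/
noncomputable def phi (s : Solution X) (x : X) : Equiv.Perm X :=
  (Equiv.ofBijective (fMap s.S x) (s.bijective_f x)).symm

variable {V : Type*} [AddCommGroup V] [Module ℝ V]

open Classical in
/-- For a real vector space `V` with basis `X`, the linear automorphism `ψ_x` of `V`: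
`ψ_x y = φ_x y` for `y ≠ x`, and `ψ_x x = - φ_x x` (see `psiGen_apply`). -/
noncomputable def psiGen (s : Solution X) (b : Module.Basis X ℝ V) (x : X) : V ≃ₗ[ℝ] V :=
  b.equiv ((b.reindex (s.phi x).symm).unitsSMul fun y => if y = x then -1 else 1)
    (Equiv.refl X)

open Classical in
theorem psiGen_apply (s : Solution X) (b : Module.Basis X ℝ V) (x y : X) :
    s.psiGen b x (b y) = if y = x then -b (s.phi x y) else b (s.phi x y) := by
  unfold psiGen
  rw [Module.Basis.equiv_apply]
  split_ifs with h <;> simp [Module.Basis.unitsSMul_apply, h]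

theorem S_S (s : Solution X) (p : X × X) : s.S (s.S p) = p :=
  congrFun s.involutive p

theorem f_comp_f (s : Solution X) (x y a : X) :
    fMap s.S y (fMap s.S x a) =
      fMap s.S (fMap s.S y x) (fMap s.S (gMap s.S x y) a) := by
  have h := congrArg (fun p : X × X × X => p.2.2) (congrFun s.braided (a, x, y))
  simpa [map12, map23, fMap, gMap] using h

theorem f_phi (s : Solution X) (x y : X) : fMap s.S x (s.phi x y) = y :=
  (Equiv.ofBijective (fMap s.S x) (s.bijective_f x)).apply_symm_apply y

theorem phi_f (s : Solution X) (x y : X) : s.phi x (fMap s.S x y) = y :=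
  (Equiv.ofBijective (fMap s.S x) (s.bijective_f x)).symm_apply_apply y

theorem phi_comp_phi (s : Solution X) (x y z : X) :
    s.phi x (s.phi y z) = s.phi (gMap s.S x y) (s.phi (fMap s.S y x) z) := by
  apply (s.bijective_f x).1
  apply (s.bijective_f y).1
  rw [s.f_comp_f x y (s.phi (gMap s.S x y) _)]
  simp only [f_phi]

theorem phi_eq_iff (s : Solution X) (x y z : X) : s.phi y z = x ↔ z = fMap s.S y x := by
  constructor
  · rintro rfl
    rw [f_phi]
  · rintro rfl
    rw [phi_f]

theorem psiGen_mul_psiGen (s : Solution X) (b : Module.Basis X ℝ V) (x y : X) :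
    s.psiGen b x * s.psiGen b y =
      s.psiGen b (gMap s.S x y) * s.psiGen b (fMap s.S y x) := by
  classical
  have hy : fMap s.S (fMap s.S y x) (gMap s.S x y) = y :=
    congrArg Prod.snd (s.S_S (x, y))
  apply LinearEquiv.toLinearMap_injective
  refine b.ext fun z => ?_
  rw [LinearEquiv.coe_coe, LinearEquiv.coe_coe, LinearEquiv.mul_apply, LinearEquiv.mul_apply,
    psiGen_apply, psiGen_apply]
  split_ifs with h1 h2 h2 <;>
    simp only [map_neg, psiGen_apply, phi_eq_iff, hy, s.phi_comp_phi x y] <;>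
    simp_all

/-- The representation `ψ` of the structure group in `GL(V)`, sending each `x : X` to `ψ_x`. -/
noncomputable def psi (s : Solution X) (b : Module.Basis X ℝ V) :
    s.StructureGroup →* (V ≃ₗ[ℝ] V) :=
  PresentedGroup.toGroup (f := s.psiGen b) (by
    rintro r ⟨x, y, -, rfl⟩
    simp only [map_mul, map_inv, FreeGroup.lift_apply_of]
    rw [psiGen_mul_psiGen, mul_inv_cancel])

theorem psi_gen (s : Solution X) (b : Module.Basis X ℝ V) (x : X) :
    s.psi b (s.gen x) = s.psiGen b x :=
  PresentedGroup.toGroup.of _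

/-- The group `W(X, S)`: the image of `ψ` in `GL(V)`. -/
noncomputable abbrev W (s : Solution X) (b : Module.Basis X ℝ V) : Subgroup (V ≃ₗ[ℝ] V) :=
  (s.psi b).range

/-- The surjective morphism `ψ : G(X, S) → W(X, S)`. -/
noncomputable def psiW (s : Solution X) (b : Module.Basis X ℝ V) :
    s.StructureGroup →* s.W b :=
  (s.psi b).rangeRestrict

/-- The normal subgroup `N(X, S)`: the kernel of `ψ : G(X, S) → W(X, S)`. -/
noncomputable def N (s : Solution X) (b : Module.Basis X ℝ V) : Subgroup s.StructureGroup :=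
  (s.psiW b).ker

end Solution

end YangBaxter

namespace YangBaxter

namespace Solution

variable {X : Type*}

/-! The assignment `x ↦ (e_{φ_x x}, φ_x)` extends to a morphism from the structure group to `ℤ^X ⋊
Sym(X)`. A positive word thus has coordinates in `ℕ^X`, and the defining relations only reorder them
(`ofList_perm`). A frozen element is a word with coordinates `2e_y`; under Property (C) its
permutation is trivial.

The representation `ψ` sees the permutation and the coordinates mod 2, as signs
(`psi_ofList_apply`). Every element is a product of frozen elements and their inverses times a
positive word (`exists_eq_mul_ofList`). If it lies in the kernel, the word has even coordinates, so
it is itself a product of frozen elements (`ofList_mem_frozenSubgroup`).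

Freeness comes from the affine action on `ℤ^X`, where the frozen elements act as the independent
translations by `2e_y` (`affine_frozenHom`). -/

/-! ### Frozen pairs and the permutation `x ↦ φ_x x`. -/

theorem f_apply_g (s : Solution X) (x y : X) :
    fMap s.S (fMap s.S y x) (gMap s.S x y) = y :=
  congrArg Prod.snd (s.S_S (x, y))

theorem g_apply_f (s : Solution X) (x y : X) :
    gMap s.S (gMap s.S x y) (fMap s.S y x) = x :=
  congrArg Prod.fst (s.S_S (x, y))

/-- Fixing one component suffices: involutivity and injectivity of `g_x` force the other. -/
theorem isFrozen_iff_g (s : Solution X) (x y : X) : s.IsFrozen x y ↔ gMap s.S x y = x := by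
  refine ⟨fun h => congrArg Prod.fst h, fun h => Prod.ext h ?_⟩
  have h' := s.g_apply_f x y
  rw [h] at h'
  exact (s.bijective_g x).1 (h'.trans h.symm)

theorem isFrozen_iff_f (s : Solution X) (x y : X) : s.IsFrozen x y ↔ fMap s.S y x = y := by
  refine ⟨fun h => congrArg Prod.snd h, fun h => Prod.ext ?_ h⟩
  have h' := s.f_apply_g x y
  rw [h] at h'
  exact (s.bijective_f y).1 (h'.trans h.symm)

theorem isFrozen_iff_phi (s : Solution X) (x y : X) : s.IsFrozen x y ↔ s.phi y y = x := by
  rw [isFrozen_iff_f, phi_eq_iff, eq_comm]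

theorem bijective_phi_diag (s : Solution X) : Function.Bijective fun x => s.phi x x := by
  constructor
  · intro x y (h : s.phi x x = s.phi y y)
    have hx := (s.isFrozen_iff_g _ _).1 ((s.isFrozen_iff_phi _ _).2 h)
    have hy := (s.isFrozen_iff_g _ _).1 ((s.isFrozen_iff_phi _ y).2 rfl)
    exact (s.bijective_g _).1 (hx.trans hy.symm)
  · intro x
    obtain ⟨y, hy⟩ := (s.bijective_g x).2 x
    exact ⟨y, (s.isFrozen_iff_phi _ _).1 ((s.isFrozen_iff_g _ _).2 hy)⟩

/-- The permutation `x ↦ φ_x x` of `X`, whose value at `x` forms a frozen pair with `x`. -/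
noncomputable def diag (s : Solution X) : Equiv.Perm X :=
  Equiv.ofBijective _ s.bijective_phi_diag

theorem diag_apply (s : Solution X) (x : X) : s.diag x = s.phi x x := rfl

theorem isFrozen_iff_diag (s : Solution X) (x y : X) : s.IsFrozen x y ↔ s.diag y = x :=
  s.isFrozen_iff_phi x y

/-- Through `diag`, the left action `g_x` becomes `φ_x`; this is what makes the coordinates
compatible with the relations. -/
theorem phi_diag (s : Solution X) (x y : X) : s.phi x (s.diag y) = s.diag (gMap s.S x y) := by
  rw [diag_apply, diag_apply, phi_comp_phi,
    (s.phi_eq_iff (gMap s.S x y) (fMap s.S y x) y).2 (s.f_apply_g x y).symm]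

theorem phi_mul_phi (s : Solution X) (x y : X) :
    s.phi x * s.phi y = s.phi (gMap s.S x y) * s.phi (fMap s.S y x) :=
  Equiv.ext fun z => s.phi_comp_phi x y z

theorem PropertyC.phi_mul_phi_eq_one {s : Solution X} (hC : s.PropertyC) {x y : X}
    (h : s.IsFrozen x y) : s.phi x * s.phi y = 1 := by
  ext z
  rw [Equiv.Perm.mul_apply, Equiv.Perm.one_apply, phi_eq_iff, phi_eq_iff]
  have h1 : fMap s.S y (fMap s.S x z) = z := congrFun (hC x y h).2 z
  exact h1.symm

theorem gen_mul_gen (s : Solution X) (x y : X) :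
    s.gen x * s.gen y = s.gen (gMap s.S x y) * s.gen (fMap s.S y x) := by
  by_cases h : s.S (x, y) = (x, y)
  · rw [show gMap s.S x y = x from congrArg Prod.fst h,
      show fMap s.S y x = y from congrArg Prod.snd h]
  · exact mul_inv_eq_one.1 (PresentedGroup.one_of_mem (rels := s.relators) ⟨x, y, h, rfl⟩)

/-! ### Coordinates of positive words. -/

/-- The letter `x` of `X` such that `σ (φ_x x) = y`. -/
noncomputable def letter (s : Solution X) (σ : Equiv.Perm X) (y : X) : X :=
  s.diag.symm (σ.symm y)

theorem letter_eq_iff (s : Solution X) (σ : Equiv.Perm X) (x y : X) :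
    s.letter σ y = x ↔ σ (s.diag x) = y := by
  rw [letter, Equiv.symm_apply_eq, Equiv.symm_apply_eq, eq_comm]

theorem apply_diag_letter (s : Solution X) (σ : Equiv.Perm X) (y : X) :
    σ (s.diag (s.letter σ y)) = y :=
  (s.letter_eq_iff σ _ y).1 rfl

/-- The element of the structure group with coordinates `l`, read from the permutation `σ`:
the product `x₁ ⋯ xₖ` such that the `i`-th entry of `l` is `σ φ_{x₁} ⋯ φ_{xᵢ₋₁} φ_{xᵢ} xᵢ`. -/
noncomputable def ofList (s : Solution X) : Equiv.Perm X → List X → s.StructureGroup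
  | _, [] => 1
  | σ, y :: l => s.gen (s.letter σ y) * s.ofList (σ * s.phi (s.letter σ y)) l

/-- The permutation `σ φ_{x₁} ⋯ φ_{xₖ}`, where `x₁ ⋯ xₖ` is the word of `ofList`. -/
noncomputable def permOfList (s : Solution X) : Equiv.Perm X → List X → Equiv.Perm X
  | σ, [] => σ
  | σ, y :: l => s.permOfList (σ * s.phi (s.letter σ y)) l

/-- With `f_letter`, this says that `S` turns the two-letter word with coordinates `[y, z]` into the
one with coordinates `[z, y]`. -/
theorem g_letter (s : Solution X) (σ : Equiv.Perm X) (y z : X) :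
    gMap s.S (s.letter σ y) (s.letter (σ * s.phi (s.letter σ y)) z) = s.letter σ z := by
  symm
  rw [letter_eq_iff, ← phi_diag]
  exact s.apply_diag_letter (σ * s.phi (s.letter σ y)) z

theorem f_letter (s : Solution X) (σ : Equiv.Perm X) (y z : X) :
    fMap s.S (s.letter (σ * s.phi (s.letter σ y)) z) (s.letter σ y) =
      s.letter (σ * s.phi (s.letter σ z)) y := by
  apply (s.bijective_g (s.letter σ z)).1
  rw [g_letter]
  nth_rw 1 [← s.g_letter σ y z]
  exact s.g_apply_f _ _

theorem ofList_perm (s : Solution X) {l₁ l₂ : List X} (h : l₁.Perm l₂) :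
    ∀ σ, s.ofList σ l₁ = s.ofList σ l₂ := by
  induction h with
  | nil => exact fun _ => rfl
  | cons y _ ih => exact fun σ => by rw [ofList, ofList, ih]
  | swap y z l =>
    intro σ
    simp only [ofList]
    rw [← mul_assoc, ← mul_assoc, gen_mul_gen, mul_assoc σ, mul_assoc σ, phi_mul_phi, g_letter,
      f_letter]
  | trans _ _ ih₁ ih₂ => exact fun σ => (ih₁ σ).trans (ih₂ σ)

/-- Swapping two equal coordinates changes nothing, so `S` fixes the pair. -/
theorem isFrozen_letter (s : Solution X) (σ : Equiv.Perm X) (y : X) :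
    s.IsFrozen (s.letter σ y) (s.letter (σ * s.phi (s.letter σ y)) y) :=
  (s.isFrozen_iff_g _ _).2 (s.g_letter σ y y)

/-! ### Frozen elements and factorization of the group. -/

/-- The frozen element with coordinates `[y, y]`. -/
noncomputable def frozen (s : Solution X) (y : X) : s.StructureGroup := s.ofList 1 [y, y]

theorem gen_mul_gen_eq_frozen (s : Solution X) {x x' : X} (h : s.IsFrozen x x') :
    s.gen x * s.gen x' = s.frozen (s.diag x) := by
  have h1 : s.letter 1 (s.diag x) = x := (s.letter_eq_iff _ _ _).2 rfl
  have h2 : s.letter (1 * s.phi x) (s.diag x) = x' := by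
    rw [letter_eq_iff, one_mul, phi_diag, (s.isFrozen_iff_g _ _).1 h]
  simp only [frozen, ofList, mul_one]
  rw [h1, h2]

theorem frozenElements_eq_range (s : Solution X) : s.frozenElements = Set.range s.frozen := by
  ext a
  constructor
  · rintro ⟨x, y, h, rfl⟩
    exact ⟨_, (s.gen_mul_gen_eq_frozen h).symm⟩
  · rintro ⟨y, rfl⟩
    exact ⟨_, _, s.isFrozen_letter 1 y, by simp only [frozen, ofList, mul_one]⟩

theorem frozen_mem (s : Solution X) (y : X) : s.frozen y ∈ s.frozenSubgroup :=
  Subgroup.subset_closure (s.frozenElements_eq_range ▸ ⟨y, rfl⟩)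

/-- A repeated coordinate contributes a frozen pair, whose permutation is trivial by Property (C),
so the rest of the word is still read from `σ`. -/
theorem PropertyC.ofList_cons_cons {s : Solution X} (hC : s.PropertyC) (σ : Equiv.Perm X)
    (y : X) (l : List X) :
    s.ofList σ (y :: y :: l) = s.frozen (s.diag (s.letter σ y)) * s.ofList σ l := by
  have h := s.isFrozen_letter σ y
  simp only [ofList]
  rw [← mul_assoc, s.gen_mul_gen_eq_frozen h, mul_assoc σ, hC.phi_mul_phi_eq_one h, mul_one]

theorem PropertyC.ofList_one_cons_cons {s : Solution X} (hC : s.PropertyC)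
    (y : X) (l : List X) : s.ofList 1 (y :: y :: l) = s.frozen y * s.ofList 1 l := by
  rw [hC.ofList_cons_cons]
  congr
  exact s.apply_diag_letter 1 y

theorem PropertyC.frozen_mul_comm {s : Solution X} (hC : s.PropertyC) (y z : X) :
    s.frozen y * s.frozen z = s.frozen z * s.frozen y := by
  change s.frozen y * s.ofList 1 [z, z] = s.frozen z * s.ofList 1 [y, y]
  rw [← hC.ofList_one_cons_cons, ← hC.ofList_one_cons_cons]
  exact s.ofList_perm (List.perm_append_comm (l₁ := [y, y]) (l₂ := [z, z])) 1

theorem ofList_mul_left (s : Solution X) (τ : Equiv.Perm X) (l : List X) :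
    ∀ σ, s.ofList (τ * σ) (l.map τ) = s.ofList σ l := by
  induction l with
  | nil => exact fun _ => rfl
  | cons y l ih =>
    intro σ
    have h : s.letter (τ * σ) (τ y) = s.letter σ y := by
      rw [letter_eq_iff, Equiv.Perm.mul_apply, apply_diag_letter]
    rw [List.map_cons, ofList, ofList, h, mul_assoc, ih]

/-- The cocycle rule: left multiplication by `x` acts on coordinates by `v ↦ φ_x v + e_{φ_x x}`. -/
theorem gen_mul_ofList_one (s : Solution X) (x : X) (l : List X) :
    s.gen x * s.ofList 1 l = s.ofList 1 (s.diag x :: l.map (s.phi x)) := by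
  have h : s.letter 1 (s.diag x) = x := (s.letter_eq_iff _ _ _).2 rfl
  rw [ofList, h, one_mul, ← s.ofList_mul_left (s.phi x) l 1, mul_one]

theorem ofList_one_singleton (s : Solution X) (x : X) : s.ofList 1 [s.diag x] = s.gen x := by
  simpa [ofList] using (s.gen_mul_ofList_one x []).symm

/-- Both sides have the coordinates `φ_x y`, `φ_x y`, `φ_x x`, in different orders. -/
theorem PropertyC.gen_mul_frozen {s : Solution X} (hC : s.PropertyC) (x y : X) :
    s.gen x * s.frozen y = s.frozen (s.phi x y) * s.gen x := by
  rw [frozen, gen_mul_ofList_one, ← s.ofList_one_singleton x, ← hC.ofList_one_cons_cons]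
  exact s.ofList_perm
    (List.perm_append_comm (l₁ := [s.diag x]) (l₂ := [s.phi x y, s.phi x y])) 1

theorem closure_range_gen (s : Solution X) : Subgroup.closure (Set.range s.gen) = ⊤ :=
  PresentedGroup.closure_range_of _

theorem PropertyC.exists_gen_mul {s : Solution X} (hC : s.PropertyC) (x : X)
    {a : s.StructureGroup} (ha : a ∈ s.frozenSubgroup) :
    ∃ a' ∈ s.frozenSubgroup, s.gen x * a = a' * s.gen x := by
  induction ha using Subgroup.closure_induction with
  | mem a ha =>
    rw [frozenElements_eq_range] at ha
    obtain ⟨y, rfl⟩ := ha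
    exact ⟨_, s.frozen_mem _, hC.gen_mul_frozen x y⟩
  | one => exact ⟨1, one_mem _, by simp⟩
  | mul a b _ _ iha ihb =>
    obtain ⟨a', ha', h⟩ := iha
    obtain ⟨b', hb', h'⟩ := ihb
    exact ⟨_, mul_mem ha' hb', by rw [← mul_assoc, h, mul_assoc, h', mul_assoc]⟩
  | inv a _ iha =>
    obtain ⟨a', ha', h⟩ := iha
    refine ⟨_, inv_mem ha', ?_⟩
    rw [eq_inv_mul_iff_mul_eq, ← mul_assoc, ← h, mul_inv_cancel_right]

theorem PropertyC.exists_eq_mul_ofList {s : Solution X} (hC : s.PropertyC)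
    (g : s.StructureGroup) : ∃ a ∈ s.frozenSubgroup, ∃ l, g = a * s.ofList 1 l := by
  have key : ∀ x g, (∃ a ∈ s.frozenSubgroup, ∃ l, g = a * s.ofList 1 l) →
      ∃ a ∈ s.frozenSubgroup, ∃ l, s.gen x * g = a * s.ofList 1 l := by
    rintro x _ ⟨a, ha, l, rfl⟩
    obtain ⟨a', ha', h⟩ := hC.exists_gen_mul x ha
    exact ⟨a', ha', _, by rw [← mul_assoc, h, mul_assoc, gen_mul_ofList_one]⟩
  have hg : g ∈ Subgroup.closure (Set.range s.gen) := s.closure_range_gen ▸ Subgroup.mem_top g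
  induction hg using Subgroup.closure_induction_left with
  | one => exact ⟨1, one_mem _, [], by simp [ofList]⟩
  | mul_left x hx g _ ih =>
    obtain ⟨x, rfl⟩ := hx
    exact key x g ih
  | inv_mul_cancel x hx g _ ih =>
    obtain ⟨x, rfl⟩ := hx
    -- Since `(diag x, x)` is frozen, `x⁻¹` is the inverse of a frozen element times the generator
    -- `diag x`.
    obtain ⟨a, ha, l, h⟩ := key (s.diag x) g ih
    have hf := s.gen_mul_gen_eq_frozen ((s.isFrozen_iff_diag _ x).2 rfl)
    refine ⟨_, mul_mem (inv_mem (s.frozen_mem (s.diag (s.diag x)))) ha, l, ?_⟩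
    rw [mul_assoc, ← h, ← hf]
    group

theorem PropertyC.ofList_mem_frozenSubgroup {s : Solution X} (hC : s.PropertyC) [DecidableEq X] :
    ∀ l : List X, (∀ y, Even (l.count y)) → s.ofList 1 l ∈ s.frozenSubgroup := by
  intro l
  induction hn : l.length using Nat.strong_induction_on generalizing l with
  | _ n ih =>
    intro hl
    cases l with
    | nil => exact one_mem _
    | cons y l =>
      have hy : y ∈ l := by
        by_contra h
        have h' := hl y
        rw [List.count_cons_self, List.count_eq_zero_of_not_mem h] at h'
        exact absurd h' (by decide)
      have hp : (y :: l).Perm (y :: y :: l.erase y) := (List.perm_cons_erase hy).cons y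
      rw [s.ofList_perm hp, hC.ofList_one_cons_cons]
      refine mul_mem (s.frozen_mem y) (ih (l.erase y).length ?_ _ rfl fun z => ?_)
      · rw [← hn, hp.length_eq]
        simp
      · have h' := hl z
        rw [hp.count_eq, List.count_cons, List.count_cons] at h'
        split_ifs at h' with hz
        · simpa [parity_simps] using h'
        · exact h'

/-! ### The kernel of `ψ`, through signed permutations. -/

section Representation

variable {V : Type*} [AddCommGroup V] [Module ℝ V]

theorem psi_ofList_apply (s : Solution X) (b : Module.Basis X ℝ V) [DecidableEq X]
    (l : List X) (z : X) : ∀ σ : Equiv.Perm X, s.psi b (s.ofList σ l) (b z) =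
      (-1 : ℝ) ^ l.count (s.permOfList σ l z) • b (σ.symm (s.permOfList σ l z)) := by
  induction l with
  | nil => simp [ofList, permOfList]
  | cons y l ih =>
    intro σ
    rw [ofList, permOfList, map_mul, LinearEquiv.mul_apply, ih, map_smul, psi_gen, psiGen_apply]
    set w := s.permOfList (σ * s.phi (s.letter σ y)) l z
    have hw : s.phi (s.letter σ y) ((σ * s.phi (s.letter σ y)).symm w) = σ.symm w := by
      rw [Equiv.eq_symm_apply]
      exact (σ * s.phi (s.letter σ y)).apply_symm_apply w
    -- The first letter contributes a sign exactly when its coordinate is `w`.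
    have hiff : (σ * s.phi (s.letter σ y)).symm w = s.letter σ y ↔ y = w := by
      rw [Equiv.symm_apply_eq, Equiv.Perm.mul_apply, ← diag_apply, apply_diag_letter, eq_comm]
    rw [hw, List.count_cons]
    by_cases h : y = w
    · rw [if_pos (hiff.2 h), if_pos (beq_iff_eq.2 h), pow_succ]
      simp
    · rw [if_neg (mt hiff.1 h), if_neg (mt beq_iff_eq.1 h), add_zero]

theorem even_count_of_psi_ofList_eq_one (s : Solution X) (b : Module.Basis X ℝ V)
    [DecidableEq X] {l : List X} (h : s.psi b (s.ofList 1 l) = 1) (z : X) :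
    Even (l.count z) := by
  have h1 := s.psi_ofList_apply b l z 1
  rw [h, LinearEquiv.coe_one, id] at h1
  set w := s.permOfList 1 l z
  have h2 : b.repr (b z) w = b.repr ((-1 : ℝ) ^ l.count w • b w) w := by rw [h1]; rfl
  -- Otherwise the coefficients at `w` would give `0 = ±1`.
  have hwz : z = w := by
    by_contra hne
    rw [map_smul, b.repr_self, b.repr_self, Finsupp.single_eq_of_ne' hne] at h2
    rcases neg_one_pow_eq_or ℝ (l.count w) with h3 | h3 <;> simp [h3] at h2
  rw [map_smul, ← hwz, b.repr_self] at h2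
  by_contra hodd
  rw [(Nat.not_even_iff_odd.1 hodd).neg_one_pow] at h2
  norm_num at h2

theorem PropertyC.psi_frozen {s : Solution X} (hC : s.PropertyC) (b : Module.Basis X ℝ V)
    (y : X) : s.psi b (s.frozen y) = 1 := by
  classical
  have hp : s.permOfList 1 [y, y] = 1 := by
    simp only [permOfList]
    rw [mul_assoc, hC.phi_mul_phi_eq_one (s.isFrozen_letter 1 y), mul_one]
  apply LinearEquiv.toLinearMap_injective
  refine b.ext fun z => ?_
  rw [LinearEquiv.coe_coe, LinearEquiv.coe_coe, frozen, psi_ofList_apply, hp]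
  have hz : b ((Equiv.symm (1 : Equiv.Perm X)) z) = b z := rfl
  by_cases h : y = z <;> simp [h, hz]

theorem PropertyC.N_eq_frozenSubgroup {s : Solution X} (hC : s.PropertyC)
    (b : Module.Basis X ℝ V) : s.N b = s.frozenSubgroup := by
  classical
  rw [N, psiW, MonoidHom.ker_rangeRestrict]
  have hle : s.frozenSubgroup ≤ (s.psi b).ker := by
    rw [frozenSubgroup, Subgroup.closure_le, frozenElements_eq_range]
    rintro _ ⟨y, rfl⟩
    exact hC.psi_frozen b y
  refine le_antisymm (fun g hg => ?_) hle
  obtain ⟨a, ha, l, rfl⟩ := hC.exists_eq_mul_ofList g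
  refine mul_mem ha (hC.ofList_mem_frozenSubgroup l fun y => ?_)
  refine s.even_count_of_psi_ofList_eq_one b ?_ y
  rwa [MonoidHom.mem_ker, map_mul, MonoidHom.mem_ker.1 (hle ha), one_mul] at hg

end Representation

/-! ### The affine action on `ℤ^X` and freeness. -/

open Classical in
/-- The affine permutation `v ↦ φ_x v + e_{φ_x x}` of `ℤ^X`. -/
noncomputable def affineGen (s : Solution X) (x : X) : Equiv.Perm (X → ℤ) :=
  (Equiv.arrowCongr (s.phi x) (Equiv.refl ℤ)).trans (Equiv.addRight (Pi.single (s.diag x) 1))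

open Classical in
theorem affineGen_apply (s : Solution X) (x : X) (v : X → ℤ) :
    s.affineGen x v = v ∘ (s.phi x).symm + Pi.single (s.diag x) 1 := rfl

open Classical in
theorem affineGen_mul_apply (s : Solution X) (x y : X) (v : X → ℤ) :
    (s.affineGen x * s.affineGen y) v =
      v ∘ (s.phi x * s.phi y).symm +
        (Pi.single (s.diag (gMap s.S x y)) 1 + Pi.single (s.diag x) 1) := by
  rw [Equiv.Perm.mul_apply, affineGen_apply, affineGen_apply, ← phi_diag, ← add_assoc]
  congr 1
  ext z
  simp [Pi.single_apply, Equiv.symm_apply_eq, Equiv.Perm.mul_def]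

/-- The action of the structure group on `ℤ^X` by affine permutations. -/
noncomputable def affine (s : Solution X) : s.StructureGroup →* Equiv.Perm (X → ℤ) :=
  PresentedGroup.toGroup (f := s.affineGen) (by
    rintro r ⟨x, y, -, rfl⟩
    simp only [map_mul, map_inv, FreeGroup.lift_apply_of]
    rw [mul_inv_eq_one]
    ext1 v
    -- Passing from `(x, y)` to `S (x, y)` swaps the two summands of the translation part.
    rw [affineGen_mul_apply, affineGen_mul_apply, g_apply_f, ← phi_mul_phi]
    exact congrArg _ (add_comm _ _))

theorem affine_gen (s : Solution X) (x : X) : s.affine (s.gen x) = s.affineGen x :=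
  PresentedGroup.toGroup.of _

open Classical in
theorem PropertyC.affine_frozen {s : Solution X} (hC : s.PropertyC) (y : X) (v : X → ℤ) :
    s.affine (s.frozen y) v = v + (2 : ℤ) • Pi.single y 1 := by
  have h := s.isFrozen_letter 1 y
  have hy : s.diag (s.letter 1 y) = y := s.apply_diag_letter 1 y
  rw [← hy, ← s.gen_mul_gen_eq_frozen h, map_mul, affine_gen, affine_gen, affineGen_mul_apply,
    hC.phi_mul_phi_eq_one h, (s.isFrozen_iff_g _ _).1 h, two_smul]
  rfl

theorem PropertyC.frozen_injective {s : Solution X} (hC : s.PropertyC) :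
    Function.Injective s.frozen := by
  classical
  intro y z h
  have h1 := hC.affine_frozen y 0
  rw [h, hC.affine_frozen z 0] at h1
  have h2 := congrFun h1 y
  by_contra hne
  simp [hne] at h2

theorem PropertyC.isMulCommutative {s : Solution X} (hC : s.PropertyC) :
    IsMulCommutative s.frozenSubgroup :=
  Subgroup.isMulCommutative_closure (by
    rw [frozenElements_eq_range]
    rintro _ ⟨y, rfl⟩ _ ⟨z, rfl⟩
    exact hC.frozen_mul_comm y z)

/-- The frozen subgroup is a commutative group under Property (C). -/
noncomputable abbrev PropertyC.commGroup {s : Solution X} (hC : s.PropertyC) :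
    CommGroup s.frozenSubgroup :=
  { (inferInstance : Group s.frozenSubgroup) with mul_comm := hC.isMulCommutative.is_comm.comm }

/-- The morphism from the free abelian group on `X` to the frozen subgroup that sends `y` to the
frozen element with coordinates `[y, y]`. -/
noncomputable def PropertyC.frozenHom {s : Solution X} (hC : s.PropertyC) :
    FreeAbelianGroup X →+ Additive s.frozenSubgroup :=
  letI := hC.commGroup
  FreeAbelianGroup.lift fun y => Additive.ofMul (⟨s.frozen y, s.frozen_mem y⟩ : s.frozenSubgroup)

theorem PropertyC.frozenHom_of {s : Solution X} (hC : s.PropertyC) (y : X) :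
    ((hC.frozenHom (FreeAbelianGroup.of y)).toMul : s.StructureGroup) = s.frozen y := by
  let := hC.commGroup
  exact congrArg (fun a : Additive s.frozenSubgroup => (a.toMul : s.StructureGroup))
    (FreeAbelianGroup.lift_apply_of _ y)

/-- Evaluating this translation at `0` recovers `2u`, hence `u`: this is the injectivity of
`frozenHom`. -/
theorem PropertyC.affine_frozenHom {s : Solution X} (hC : s.PropertyC) (u : FreeAbelianGroup X) :
    ∀ v, s.affine (hC.frozenHom u).toMul v = v + (2 : ℤ) • ⇑(FreeAbelianGroup.toFinsupp u) := by
  classical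
  induction u using FreeAbelianGroup.induction_on with
  | zero => simp
  | of y =>
    intro v
    rw [frozenHom_of, hC.affine_frozen, FreeAbelianGroup.toFinsupp_of, Finsupp.single_eq_pi_single]
  | neg y ih =>
    intro v
    rw [map_neg, toMul_neg, Subgroup.coe_inv, map_inv, Equiv.Perm.inv_eq_iff_eq, ih, map_neg,
      Finsupp.coe_neg]
    simp
  | add u u' hu hu' =>
    intro v
    rw [map_add, toMul_add, Subgroup.coe_mul, map_mul, Equiv.Perm.mul_apply, hu', hu, map_add,
      Finsupp.coe_add, smul_add, add_assoc, add_comm ((2 : ℤ) • ⇑(FreeAbelianGroup.toFinsupp u'))]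

theorem PropertyC.frozenHom_injective {s : Solution X} (hC : s.PropertyC) :
    Function.Injective hC.frozenHom := by
  rw [injective_iff_map_eq_zero]
  intro u hu
  have h := hC.affine_frozenHom u 0
  rw [hu, toMul_zero, Subgroup.coe_one, map_one, Equiv.Perm.one_apply, zero_add] at h
  have h' : FreeAbelianGroup.toFinsupp u = 0 := by
    ext y
    simpa using (congrFun h y).symm
  exact (FreeAbelianGroup.equivFinsupp X).injective (h'.trans (map_zero _).symm)

theorem PropertyC.frozenHom_surjective {s : Solution X} (hC : s.PropertyC) :
    Function.Surjective hC.frozenHom := by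
  have key : ∀ a ∈ s.frozenSubgroup, ∃ u, ((hC.frozenHom u).toMul : s.StructureGroup) = a := by
    intro a ha
    induction ha using Subgroup.closure_induction with
    | mem a ha =>
      rw [frozenElements_eq_range] at ha
      obtain ⟨y, rfl⟩ := ha
      exact ⟨_, hC.frozenHom_of y⟩
    | one => exact ⟨0, by simp⟩
    | mul a b _ _ iha ihb =>
      obtain ⟨u, rfl⟩ := iha
      obtain ⟨u', rfl⟩ := ihb
      exact ⟨u + u', by simp⟩
    | inv a _ iha =>
      obtain ⟨u, rfl⟩ := iha
      exact ⟨-u, by simp⟩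
  intro a
  obtain ⟨u, hu⟩ := key a.toMul a.toMul.2
  exact ⟨u, Additive.toMul.injective (Subtype.ext hu)⟩

/-- The frozen subgroup is freely generated, as an abelian group, by the frozen elements. -/
noncomputable def PropertyC.frozenEquiv {s : Solution X} (hC : s.PropertyC) :
    FreeAbelianGroup X ≃+ Additive s.frozenSubgroup :=
  AddEquiv.ofBijective hC.frozenHom ⟨hC.frozenHom_injective, hC.frozenHom_surjective⟩

theorem PropertyC.frozenEquiv_of {s : Solution X} (hC : s.PropertyC) (y : X) :
    ((hC.frozenEquiv (FreeAbelianGroup.of y)).toMul : s.StructureGroup) = s.frozen y :=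
  hC.frozenHom_of y

/-- The bijection between `X` and the frozen elements. -/
noncomputable def PropertyC.equivFrozenElements {s : Solution X} (hC : s.PropertyC) :
    X ≃ s.frozenElements :=
  (Equiv.ofInjective _ hC.frozen_injective).trans (Equiv.setCongr s.frozenElements_eq_range.symm)

theorem PropertyC.coe_equivFrozenElements {s : Solution X} (hC : s.PropertyC) (y : X) :
    (hC.equivFrozenElements y : s.StructureGroup) = s.frozen y := rfl

end Solution

end YangBaxter

theorem mainTheorem3 {X : Type*} [Finite X] (s : YangBaxter.Solution X)
    {V : Type*} [AddCommGroup V] [Module ℝ V] (b : Module.Basis X ℝ V)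
    (hC : s.PropertyC) :
    -- the kernel of `ψ` is the frozen subgroup
    s.N b = s.frozenSubgroup ∧
    -- there are exactly `n` frozen elements
    s.frozenElements.ncard = Nat.card X ∧
    -- the frozen subgroup is free abelian, freely generated by the frozen elements
    (∃ e : Multiplicative (FreeAbelianGroup s.frozenElements) ≃* s.frozenSubgroup,
      ∀ a : s.frozenElements,
        (e (Multiplicative.ofAdd (FreeAbelianGroup.of a)) : s.StructureGroup) = a) ∧
    -- its rank is `n`
    Nonempty (s.frozenSubgroup ≃* Multiplicative (Fin (Nat.card X) → ℤ)) ∧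
    -- the sequence `1 → N(X, S) → G(X, S) → W(X, S) → 1` is exact
    (Function.Injective (s.N b).subtype ∧
      (s.N b).subtype.range = (s.psiW b).ker ∧
      Function.Surjective (s.psiW b)) := by
  refine ⟨hC.N_eq_frozenSubgroup b, ?_, ?_, ?_, (s.N b).subtype_injective,
    (s.N b).range_subtype, (s.psi b).rangeRestrict_surjective⟩
  · rw [← Nat.card_coe_set_eq]
    exact (Nat.card_congr hC.equivFrozenElements).symm
  · refine ⟨AddEquiv.toMultiplicativeLeft
      ((FreeAbelianGroup.equivOfEquiv hC.equivFrozenElements).symm.trans hC.frozenEquiv),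
      fun a => ?_⟩
    obtain ⟨y, rfl⟩ := hC.equivFrozenElements.surjective a
    rw [hC.coe_equivFrozenElements, ← hC.frozenEquiv_of]
    change ((hC.frozenEquiv ((FreeAbelianGroup.equivOfEquiv hC.equivFrozenElements).symm
      (FreeAbelianGroup.of (hC.equivFrozenElements y)))).toMul : s.StructureGroup) = _
    congr 3
    rw [AddEquiv.symm_apply_eq]
    rfl
  · have e : (X →₀ ℤ) ≃+ (Fin (Nat.card X) → ℤ) :=
      ((Finsupp.linearEquivFunOnFinite ℤ ℤ X).trans
        (LinearEquiv.funCongrLeft ℤ ℤ (Finite.equivFin X).symm)).toAddEquiv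
    exact ⟨AddEquiv.toMultiplicativeRight
      ((hC.frozenEquiv.symm.trans (FreeAbelianGroup.equivFinsupp X)).trans e)⟩
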